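/- For $n\ge 1$ let $\mathbb{Z}_n=\{0,1,\dots,n-1\}$ and let $f:\mathbb{Z}_n^2\to\mathbb{Z}_n$ be a two-neighbor cellular automaton rule chosen uniformly at random among all $n^{n^2}$ such rules (probability $\mathbb{P}$). From an initial configuration $\xi_0:\mathbb{Z}\to\mathbb{Z}_n$ the rule generates the trajectory $\xi_{t+1}(x)=f(\xi_t(x-1),\xi_t(x))$, $x\in\mathbb{Z}$, $t\ge 0$. The trajectory is a periodic solution of $f$ with temporal period $\tau\ge1$ and spatial period $\sigma\ge 1$ if $\sigma$ is the smallest positive integer with $\xi_0(x+\sigma)=\xi_0(x)$ for all $x\in\mathbb{Z}$ and $\tau$ is the smallest positive integer with $\xi_\tau(x)=\xi_0(x)$ for all $x\in\mathbb{Z}$. Periodic solutions that are space-time translates of each other are identified, and $\mathcal{P}_{\tau,\sigma,n}$ denotes the (random) set of periodic solutions of $f$ with temporal period $\tau$ and spatial period $\sigma$. For $\mathcal{T},\Sigma\subset\{1,2,\dots\}$ put $\mathcal{P}_{\mathcal{T},\Sigma,n}=\bigcup_{(\tau,\sigma)\in\mathcal{T}\times\Sigma}\mathcal{P}_{\tau,\sigma,n}$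 and $$\lambda_{\mathcal{T},\Sigma}=\sum_{(\tau,\sigma)\in\mathcal{T}\times\Sigma}\lambda_{\tau,\sigma},\qquad \lambda_{\tau,\sigma}=\frac{1}{\tau\sigma}\sum_{d\mid\gcd(\tau,\sigma)}\varphi(d)\,d,$$ where $\varphi$ is the Euler totient function. **Theorem.** If $\mathcal{T}\times\Sigma$ is finite, then $\mathbb{P}(\mathcal{P}_{\mathcal{T},\Sigma,n}\neq\emptyset)\to 1-\exp(-\lambda_{\mathcal{T},\Sigma})$ as $n\to\infty$. -/

import Mathlib

open Filter Topology

/-- A two-neighbor rule with `n` states `0, …, n - 1`: a map `f` from pairs of states to states. -/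
abbrev Rule (n : ℕ) : Type := Fin n × Fin n → Fin n

/-- A space-time configuration `(x, t) ↦ ξ x t` on `ℤ × ℤ₊`. -/
abbrev SpaceTime (n : ℕ) : Type := ℤ → ℕ → Fin n

/-- `ξ` is the space-time configuration generated by the rule `f` from its initial row. -/
def IsTrajectory {n : ℕ} (f : Rule n) (ξ : SpaceTime n) : Prop :=
  ∀ (x : ℤ) (t : ℕ), ξ x (t + 1) = f (ξ (x - 1) t, ξ x t)

/-- `ξ` is a periodic solution of the rule `f` with temporal period `τ` and spatial period `σ`:
it is a trajectory of `f`, and `σ`, `τ` are the smallest positive integers with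
`ξ₀(x + σ) = ξ₀(x)` for all `x` and `ξ_τ(x) = ξ₀(x)` for all `x`. -/
def IsPeriodicSolution {n : ℕ} (f : Rule n) (τ σ : ℕ) (ξ : SpaceTime n) : Prop :=
  IsTrajectory f ξ ∧
  IsLeast {s : ℕ | 0 < s ∧ ∀ x : ℤ, ξ (x + s) 0 = ξ x 0} σ ∧
  IsLeast {t : ℕ | 0 < t ∧ ∀ x : ℤ, ξ x t = ξ x 0} τ

/-- All spatial and temporal translates of a space-time configuration. On periodic solutions, two
of these sets are equal exactly when the solutions are translates of each other. -/
def translates {n : ℕ} (ξ : SpaceTime n) : Set (SpaceTime n) :=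
  {η | ∃ (a : ℤ) (k : ℕ), ∀ (x : ℤ) (t : ℕ), η x t = ξ (x + a) (t + k)}

/-- The set of periodic solutions of `f` with temporal period `τ` and spatial period `σ`, where
translates in space and time are not distinguished. -/
def periodicSolutions {n : ℕ} (f : Rule n) (τ σ : ℕ) : Set (Set (SpaceTime n)) :=
  translates '' {ξ | IsPeriodicSolution f τ σ ξ}

/-- The union of `periodicSolutions f τ σ` over `(τ, σ) ∈ T × S`. -/
def periodicSolutionsIn {n : ℕ} (f : Rule n) (T S : Set ℕ) : Set (Set (SpaceTime n)) :=
  ⋃ p ∈ T ×ˢ S, periodicSolutions f p.1 p.2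

/-- The uniform probability on the rules with `n` states. -/
noncomputable def uniformRule (n : ℕ) : MeasureTheory.Measure (Rule n) :=
  ProbabilityTheory.uniformOn Set.univ

/-- `λ_{τ,σ} = (1 / (τ σ)) ∑_{d ∣ gcd(τ, σ)} φ(d) d`. -/
noncomputable def periodRate (τ σ : ℕ) : ℝ :=
  1 / ((τ : ℝ) * (σ : ℝ)) * ∑ d ∈ (Nat.gcd τ σ).divisors, (Nat.totient d : ℝ) * (d : ℝ)

/-! All admissible periods divide one integer `M`, so every solution in question unrolls a pattern
`w` on the torus `(ℤ/M)²`. If `w` uses `s` states and `k` neighbouring pairs, a random rule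
generates it with probability at most `n^(-k)`, and `O(n^s)` patterns use `s` states. Always `k ≥
s`, so patterns with `k > s` appear only with probability `O(1/n)`. If `k = s`, a state determines
its left neighbour and hence, by the rule, its successor; equality of states then spreads to all
translates (`isRegularPattern_of_generates`).

A regular pattern amounts to its period subgroup `L` and an injection of the quotient into the
states (`regularPatternEquiv`). Let `m` be the index of `L`. Requiring the minimum at the origin
selects one translate, so about `n^m / m` patterns, each of probability `n^(-m)`, contribute mean
`1/m`. Subgroups with axis periods `σ, τ` correspond to subgroups of `ℤ_σ × ℤ_τ` meeting the axes
only in zero. These are cyclic, generated by `(a, τ/d)` with `d ∣ τ` the order of `a`, and have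
index `στ/d`. Each `d ∣ gcd(τ, σ)` allows `φ(d)` choices of `a`, so the means sum to `λ`
(`sum_inv_index_eq_periodRate`).

Patterns with disjoint footprints are independent. Two distinct rooted patterns whose footprints
meet either cannot coexist or jointly use more pairs than states, so dependence costs `O(1/n)`, and
`abs_weightOf_forall_not_sub_exp_le` gives probability close to `exp(-λ)` that no solution exists.
-/

/-! ### A Poisson approximation for dissociated events -/

section PoissonApproximation

open Finset

open scoped Classical in
/-- The total weight of the outcomes satisfying `P`. -/
noncomputable def weightOf {Ω : Type*} [Fintype Ω] (μ : Ω → ℝ) (P : Ω → Prop) : ℝ :=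
  ∑ ω, μ ω * if P ω then 1 else 0

theorem weightOf_mono {Ω : Type*} [Fintype Ω] {μ : Ω → ℝ} (hμ : ∀ ω, 0 ≤ μ ω) {P Q : Ω → Prop}
    (h : ∀ ω, P ω → Q ω) : weightOf μ P ≤ weightOf μ Q := by
  classical
  unfold weightOf
  refine sum_le_sum fun ω _ => mul_le_mul_of_nonneg_left ?_ (hμ ω)
  have := h ω
  by_cases hP : P ω
  · simp [hP, h ω hP]
  · simp only [hP, if_false]
    split_ifs <;> norm_num

theorem weightOf_nonneg {Ω : Type*} [Fintype Ω] {μ : Ω → ℝ} (hμ : ∀ ω, 0 ≤ μ ω) (P : Ω → Prop) :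
    0 ≤ weightOf μ P := by
  classical
  unfold weightOf
  exact sum_nonneg fun ω _ => mul_nonneg (hμ ω) (by split_ifs <;> norm_num)

theorem weightOf_exists_le {Ω ι : Type*} [Fintype Ω] [Fintype ι] {μ : Ω → ℝ}
    (hμ : ∀ ω, 0 ≤ μ ω) (P : ι → Ω → Prop) :
    weightOf μ (fun ω => ∃ i, P i ω) ≤ ∑ i, weightOf μ (P i) := by
  classical
  unfold weightOf
  rw [sum_comm]
  refine sum_le_sum fun ω _ => ?_
  rw [← mul_sum]
  refine mul_le_mul_of_nonneg_left ?_ (hμ ω)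
  split_ifs with h
  · obtain ⟨i, hi⟩ := h
    refine le_trans (le_of_eq ?_) (single_le_sum (f := fun i => if P i ω then (1 : ℝ) else 0)
      (fun i _ => by split_ifs <;> norm_num) (mem_univ i))
    simp [hi]
  · exact sum_nonneg fun i _ => by split_ifs <;> norm_num

theorem abs_pow_add_sub_pow_le {s : ℝ} (h0 : 0 ≤ s) (h1 : s ≤ 1) (k m : ℕ) :
    |s ^ (k + m) - s ^ k| ≤ m := by
  rcases Nat.eq_zero_or_pos m with rfl | hm
  · simp
  · have a1 := pow_le_one₀ h0 h1 (n := k + m)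
    have a2 := pow_le_one₀ h0 h1 (n := k)
    have a3 := pow_nonneg h0 (k + m)
    have a4 := pow_nonneg h0 k
    have : (1 : ℝ) ≤ m := by exact_mod_cast hm
    rw [abs_le]
    constructor <;> linarith

open scoped Classical in
/-- Poisson approximation for the probability that none of the events `E i` occurs, when each
`E i` is independent of the events that are not related to it by `r`. -/
theorem abs_weightOf_forall_not_sub_exp_le {Ω ι : Type*} [Fintype Ω] (μ : Ω → ℝ)
    (hμ : ∀ ω, 0 ≤ μ ω) (hμ1 : ∑ ω, μ ω = 1) (I : Finset ι) (E : ι → Ω → Prop)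
    (r : ι → ι → Prop) (hr : ∀ i ∈ I, r i i)
    (hind : ∀ i ∈ I, ∀ s : ℝ,
      ∑ ω, μ ω * ((if E i ω then 1 else 0) * s ^ #{j ∈ I | ¬ r i j ∧ E j ω}) =
        weightOf μ (E i) * ∑ ω, μ ω * s ^ #{j ∈ I | ¬ r i j ∧ E j ω}) :
    |weightOf μ (fun ω => ∀ i ∈ I, ¬ E i ω) - Real.exp (-∑ i ∈ I, weightOf μ (E i))| ≤
      ∑ i ∈ I, ∑ j ∈ I with r i j, weightOf μ (E i) * weightOf μ (E j) +
      ∑ i ∈ I, ∑ j ∈ I with r i j ∧ j ≠ i, weightOf μ (fun ω => E i ω ∧ E j ω) := by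
  set W : Ω → ℕ := fun ω => #{i ∈ I | E i ω} with hW
  set V : ι → Ω → ℕ := fun i ω => #{j ∈ I | ¬ r i j ∧ E j ω} with hV
  set lam : ℝ := ∑ i ∈ I, weightOf μ (E i) with hlam
  -- The generating function of the number `W` of occurring events nearly satisfies the Poisson
  -- equation `φ' = lam * φ`; `B` bounds the defect on `[0, 1]`.
  set φ : ℝ → ℝ := fun s => ∑ ω, μ ω * s ^ W ω with hφ
  set φ' : ℝ → ℝ := fun s => ∑ ω, μ ω * (W ω * s ^ (W ω - 1)) with hφ'
  set B : ℝ := ∑ i ∈ I, ∑ j ∈ I with r i j, weightOf μ (E i) * weightOf μ (E j) +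
      ∑ i ∈ I, ∑ j ∈ I with r i j ∧ j ≠ i, weightOf μ (fun ω => E i ω ∧ E j ω) with hB
  have hderiv : ∀ s, HasDerivAt φ (φ' s) s := fun s =>
    HasDerivAt.fun_sum fun ω _ => (hasDerivAt_pow (W ω) s).const_mul (μ ω)
  have hWsum : ∀ ω, (W ω : ℝ) = ∑ i ∈ I, if E i ω then 1 else 0 := by
    intro ω; simp [hW]
  have hdiff : ∀ s, φ' s - lam * φ s = ∑ i ∈ I,
      (∑ ω, μ ω * ((if E i ω then 1 else 0) * (s ^ (W ω - 1) - s ^ V i ω)) +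
        weightOf μ (E i) * ∑ ω, μ ω * (s ^ V i ω - s ^ W ω)) := by
    intro s
    have e1 : φ' s = ∑ i ∈ I, ∑ ω, μ ω * ((if E i ω then 1 else 0) * s ^ (W ω - 1)) := by
      rw [sum_comm]
      refine sum_congr rfl fun ω _ => ?_
      rw [← mul_sum, ← sum_mul, hWsum]
    rw [e1, hlam, sum_mul, ← sum_sub_distrib]
    refine sum_congr rfl fun i hi => ?_
    simp only [mul_sub, sum_sub_distrib]
    have := hind i hi s
    simp only [hV, hφ]
    linarith
  have hbound : ∀ s ∈ Set.Icc (0 : ℝ) 1, |φ' s - lam * φ s| ≤ B := by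
    rintro s ⟨h0, h1⟩
    rw [hdiff, hB, add_comm, ← sum_add_distrib]
    refine (abs_sum_le_sum_abs _ _).trans (sum_le_sum fun i hi => ?_)
    refine (abs_add_le _ _).trans (add_le_add ?_ ?_)
    · unfold weightOf
      rw [sum_comm]
      refine (abs_sum_le_sum_abs _ _).trans (sum_le_sum fun ω _ => ?_)
      rw [abs_mul, abs_of_nonneg (hμ ω), ← mul_sum]
      refine mul_le_mul_of_nonneg_left ?_ (hμ ω)
      by_cases hE : E i ω
      -- On `E i` the removed factor accounts for `i` itself, so the two exponents differ by the
      -- number of other related events that occur.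
      · have key : W ω - 1 = V i ω + #{j ∈ I | (r i j ∧ j ≠ i) ∧ E j ω} := by
          have : W ω = V i ω + (#{j ∈ I | (r i j ∧ j ≠ i) ∧ E j ω} + 1) := by
            have h2 : ({j ∈ I | r i j ∧ E j ω} : Finset ι) =
                insert i {j ∈ I | (r i j ∧ j ≠ i) ∧ E j ω} := by
              ext j
              simp only [mem_filter, mem_insert]
              constructor
              · rintro ⟨a, b, c⟩
                by_cases hji : j = i
                · exact Or.inl hji
                · exact Or.inr ⟨a, ⟨b, hji⟩, c⟩
              · rintro (rfl | ⟨a, ⟨b, -⟩, c⟩)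
                · exact ⟨hi, hr _ hi, hE⟩
                · exact ⟨a, b, c⟩
            rw [← card_insert_of_notMem (a := i) (by simp), ← h2]
            simp only [hW, hV]
            rw [← card_filter_add_card_filter_not (s := {i ∈ I | E i ω}) (fun j => r i j), add_comm,
              filter_filter, filter_filter]
            simp only [and_comm]
          omega
        rw [key]
        simp only [hE, if_true, one_mul, true_and]
        refine (abs_pow_add_sub_pow_le h0 h1 _ _).trans (le_of_eq ?_)
        rw [← filter_filter]
        simp
      · simp [hE]
    · rw [abs_mul, abs_of_nonneg (weightOf_nonneg hμ _), ← mul_sum]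
      refine mul_le_mul_of_nonneg_left ?_ (weightOf_nonneg hμ _)
      unfold weightOf
      rw [sum_comm]
      refine (abs_sum_le_sum_abs _ _).trans (sum_le_sum fun ω _ => ?_)
      rw [abs_mul, abs_of_nonneg (hμ ω), ← mul_sum]
      refine mul_le_mul_of_nonneg_left ?_ (hμ ω)
      have key : W ω = V i ω + #{j ∈ I | r i j ∧ E j ω} := by
        simp only [hW, hV]
        rw [← card_filter_add_card_filter_not (s := {i ∈ I | E i ω}) (fun j => r i j), add_comm,
          filter_filter, filter_filter]
        simp only [and_comm]
      rw [key, abs_sub_comm]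
      refine (abs_pow_add_sub_pow_le h0 h1 _ _).trans (le_of_eq ?_)
      rw [← filter_filter]
      simp
  have hlam0 : 0 ≤ lam := sum_nonneg fun i _ => weightOf_nonneg hμ _
  -- With the integrating factor `exp (-lam * s)`, the mean value inequality between 0 and 1
  -- compares `φ 0` with `exp (-lam)`.
  have hψ : ∀ s, HasDerivAt (fun s => Real.exp (-(lam * s)) * φ s)
      (Real.exp (-(lam * s)) * (φ' s - lam * φ s)) s := by
    intro s
    have h1 : HasDerivAt (fun s : ℝ => Real.exp (-(lam * s)))
        (Real.exp (-(lam * s)) * (-(lam * 1))) s :=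
      (((hasDerivAt_id s).const_mul lam).neg).exp
    refine (h1.mul (hderiv s)).congr_deriv ?_
    ring
  have hmv := (convex_Icc (0 : ℝ) 1).norm_image_sub_le_of_norm_hasDerivWithin_le
    (f := fun s => Real.exp (-(lam * s)) * φ s) (C := B)
    (fun s _ => (hψ s).hasDerivWithinAt) (fun s hs => by
      rw [Real.norm_eq_abs, abs_mul, abs_of_pos (Real.exp_pos _)]
      have : Real.exp (-(lam * s)) ≤ 1 := by
        rw [Real.exp_le_one_iff]
        have := mul_nonneg hlam0 hs.1
        linarith
      calc _ ≤ 1 * |φ' s - lam * φ s| := mul_le_mul_of_nonneg_right this (abs_nonneg _)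
        _ ≤ B := by rw [one_mul]; exact hbound s hs)
    (Set.left_mem_Icc.2 zero_le_one) (Set.right_mem_Icc.2 zero_le_one)
  have hφ1 : φ 1 = 1 := by simp [hφ, hμ1]
  -- Since `0 ^ 0 = 1`, the power `0 ^ W` is the indicator of `W = 0`.
  have hφ0 : φ 0 = weightOf μ (fun ω => ∀ i ∈ I, ¬ E i ω) := by
    simp only [hφ, weightOf, zero_pow_eq]
    refine sum_congr rfl fun ω _ => ?_
    congr 1
    simp [hW, filter_eq_empty_iff]
  simp only [hφ1, hφ0, mul_one, mul_zero, neg_zero, Real.exp_zero, one_mul, sub_zero, norm_one,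
    Real.norm_eq_abs] at hmv
  rw [abs_sub_comm]
  exact hmv

end PoissonApproximation

/-! ### Uniformly random functions -/

section UniformFunctions

open Finset

/-- The constant weight of the uniform distribution on a finite type. -/
noncomputable def uniformWeight (Ω : Type*) [Fintype Ω] : Ω → ℝ :=
  fun _ => (Fintype.card Ω : ℝ)⁻¹

theorem uniformWeight_nonneg (Ω : Type*) [Fintype Ω] (ω : Ω) : 0 ≤ uniformWeight Ω ω := by
  unfold uniformWeight
  positivity

theorem sum_uniformWeight (Ω : Type*) [Fintype Ω] [Nonempty Ω] :
    ∑ ω, uniformWeight Ω ω = 1 := by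
  simp [uniformWeight]

theorem uniformRule_real_eq_weightOf (n : ℕ) (P : Rule n → Prop) :
    (uniformRule n).real {f | P f} = weightOf (uniformWeight (Rule n)) P := by
  classical
  unfold uniformRule weightOf uniformWeight
  rw [MeasureTheory.measureReal_def, ProbabilityTheory.uniformOn_univ,
    MeasureTheory.Measure.count_apply (Set.toFinite _).measurableSet, ← mul_sum,
    Set.encard_eq_coe_toFinset_card]
  simp [div_eq_inv_mul]

/-- A function splits into its values on `D` and off `D`: the constraint leaves one of `|β| ^ #D`
choices for the first part, and `F` sees only the second. -/
theorem sum_agree_mul_eq {α β : Type*} [Fintype α] [DecidableEq α] [Fintype β] (D : Finset α)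
    (h : α → β) [DecidablePred fun f : α → β => ∀ a ∈ D, f a = h a] (F : (α → β) → ℝ) (hF : ∀ f g : α → β, (∀ a ∉ D, f a = g a) → F f = F g) :
    (∑ f : α → β, (if ∀ a ∈ D, f a = h a then 1 else 0) * F f) * (Fintype.card β : ℝ) ^ #D =
      ∑ f, F f := by
  classical
  let e := Equiv.piEquivPiSubtypeProd (fun a => a ∈ D) (fun _ : α => β)
  let u₀ : {a // a ∈ D} → β := fun a => h a
  have e1 : ∀ u v, F (e.symm (u, v)) = F (e.symm (u₀, v)) := fun u v => hF _ _ fun a ha => by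
    simp [e, ha]
  have e2 : ∀ u v, (∀ a ∈ D, e.symm (u, v) a = h a) ↔ u = u₀ := by
    intro u v
    constructor
    · intro H
      ext ⟨a, ha⟩
      simpa [e, ha] using H a ha
    · rintro rfl a ha
      simp [e, ha, u₀]
  have e3 : ∀ u v, (if ∀ a ∈ D, e.symm (u, v) a = h a then (1 : ℝ) else 0) =
      if u = u₀ then 1 else 0 := fun u v => if_congr (e2 u v) rfl rfl
  rw [← e.symm.sum_comp, ← e.symm.sum_comp, Fintype.sum_prod_type, Fintype.sum_prod_type]
  simp only [e3, e1]
  rw [sum_comm]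
  simp only [ite_mul, one_mul, zero_mul, sum_ite_eq', mem_univ, if_true, sum_const, card_univ,
    Fintype.card_fun, Fintype.card_coe, nsmul_eq_mul, Nat.cast_pow]
  ring

theorem sum_agree_mul_of_forall_notMem {n : ℕ} (D : Finset (Fin n × Fin n)) (h : Rule n)
    [DecidablePred fun f : Rule n => ∀ a ∈ D, f a = h a] (F : Rule n → ℝ) (hF : ∀ f g : Rule n, (∀ a ∉ D, f a = g a) → F f = F g) :
    ∑ f, uniformWeight (Rule n) f * ((if ∀ a ∈ D, f a = h a then 1 else 0) * F f) =
      ((n : ℝ) ^ #D)⁻¹ * ∑ f, uniformWeight (Rule n) f * F f := by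
  have := sum_agree_mul_eq D h F hF
  simp only [Fintype.card_fin] at this
  simp only [uniformWeight, ← mul_sum]
  rw [← this]
  have hn : ((n : ℝ) ^ #D) ≠ 0 := by
    rcases D.eq_empty_or_nonempty with rfl | ⟨a, -⟩
    · simp
    · have : 0 < n := a.1.pos
      positivity
  field_simp

theorem weightOf_agree {n : ℕ} (D : Finset (Fin n × Fin n)) (h : Rule n) :
    weightOf (uniformWeight (Rule n)) (fun f => ∀ a ∈ D, f a = h a) = ((n : ℝ) ^ #D)⁻¹ := by
  classical
  have : Nonempty (Rule n) := ⟨h⟩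
  unfold weightOf
  have := sum_agree_mul_of_forall_notMem D h (fun _ => 1) fun _ _ _ => rfl
  simp only [mul_one, sum_uniformWeight] at this
  convert this

end UniformFunctions

/-! ### Footprints of patterns -/

section Footprint

open Finset

variable {X : Type*} [Fintype X] {n : ℕ}

/-- The set of states used by `w`. -/
def stateSet (w : X → Fin n) : Finset (Fin n) := univ.image w

/-- The pairs of neighbouring states used by `w`, where `l x` is the left neighbour of `x`. -/
def footprint (l : X → X) (w : X → Fin n) : Finset (Fin n × Fin n) :=
  univ.image fun x => (w (l x), w x)

/-- The rule `f` produces the state at `d x` from the states at `l x` and `x`. -/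
def Generates (l d : X → X) (f : Rule n) (w : X → Fin n) : Prop :=
  ∀ x, w (d x) = f (w (l x), w x)

theorem mem_stateSet (w : X → Fin n) (x : X) : w x ∈ stateSet w :=
  mem_image_of_mem _ (mem_univ _)

theorem mem_footprint (l : X → X) (w : X → Fin n) (x : X) : (w (l x), w x) ∈ footprint l w :=
  mem_image_of_mem (fun x => (w (l x), w x)) (mem_univ x)

theorem image_snd_footprint (l : X → X) (w : X → Fin n) :
    (footprint l w).image Prod.snd = stateSet w := by
  simp only [footprint, stateSet, image_image]
  rfl

theorem card_stateSet_le_card_footprint (l : X → X) (w : X → Fin n) :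
    #(stateSet w) ≤ #(footprint l w) := by
  rw [← image_snd_footprint l w]
  exact card_image_le

/-- The second projection maps the footprint onto the states, so equal cardinalities force it to be
injective. -/
theorem left_eq_of_card_footprint_le {l : X → X} {w : X → Fin n}
    (h : #(footprint l w) ≤ #(stateSet w)) {x y : X} (hxy : w x = w y) : w (l x) = w (l y) := by
  have hinj : Set.InjOn Prod.snd (footprint l w : Set (Fin n × Fin n)) := by
    rw [← card_image_iff, image_snd_footprint]
    exact (card_stateSet_le_card_footprint l w).antisymm h
  exact congrArg Prod.fst (hinj (mem_footprint l w x) (mem_footprint l w y) hxy)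

theorem card_footprint_eq_of_left_eq {l : X → X} {w : X → Fin n}
    (h : ∀ x y, w x = w y → w (l x) = w (l y)) : #(footprint l w) = #(stateSet w) := by
  rw [← image_snd_footprint l w]
  refine (card_image_of_injOn ?_).symm
  intro a ha b hb hab
  simp only [footprint, coe_image, coe_univ, Set.image_univ, Set.mem_range] at ha hb
  obtain ⟨x, rfl⟩ := ha
  obtain ⟨y, rfl⟩ := hb
  exact Prod.ext (h x y hab) hab

theorem generates_iff_agree {l d : X → X} {g : Rule n} {w : X → Fin n} (hg : Generates l d g w)
    (f : Rule n) : Generates l d f w ↔ ∀ a ∈ footprint l w, f a = g a := by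
  simp only [footprint, mem_image, mem_univ, true_and, forall_exists_index, forall_apply_eq_imp_iff]
  exact forall_congr' fun x => by rw [← hg x, eq_comm]

theorem weightOf_generates {l d : X → X} {g : Rule n} {w : X → Fin n} (hg : Generates l d g w) :
    weightOf (uniformWeight (Rule n)) (fun f => Generates l d f w) =
      ((n : ℝ) ^ #(footprint l w))⁻¹ := by
  simp only [generates_iff_agree hg]
  exact weightOf_agree _ _

theorem weightOf_generates_le (l d : X → X) (w : X → Fin n) :
    weightOf (uniformWeight (Rule n)) (fun f => Generates l d f w) ≤
      ((n : ℝ) ^ #(footprint l w))⁻¹ := by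
  by_cases h : ∃ g : Rule n, Generates l d g w
  · obtain ⟨g, hg⟩ := h
    exact (weightOf_generates hg).le
  · push Not at h
    simp only [weightOf, h, if_false, mul_zero, sum_const_zero]
    positivity

theorem weightOf_generates_le_of_lt {l : X → X} {w : X → Fin n} (d : X → X)
    (h : #(stateSet w) < #(footprint l w)) :
    weightOf (uniformWeight (Rule n)) (fun f => Generates l d f w) ≤
      ((n : ℝ) ^ (#(stateSet w) + 1))⁻¹ := by
  refine (weightOf_generates_le l d w).trans ?_
  obtain ⟨a, -⟩ : (footprint l w).Nonempty := card_pos.1 (by omega)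
  have hn : (1 : ℝ) ≤ n := by exact_mod_cast a.1.pos
  have hn0 : (0 : ℝ) < n := by linarith
  gcongr
  exact h

/-- Such a map factors through `Fin s`. -/
theorem card_filter_card_stateSet_eq_le (X : Type*) [Fintype X] [DecidableEq X] (n s : ℕ) :
    #{w : X → Fin n | #(stateSet w) = s} ≤ n ^ s * s ^ Fintype.card X := by
  classical
  have h : ({w : X → Fin n | #(stateSet w) = s} : Finset _) ⊆
      (univ : Finset ((Fin s → Fin n) × (X → Fin s))).image fun p => p.1 ∘ p.2 := by
    intro w hw
    rw [mem_filter] at hw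
    let e := (stateSet w).equivFinOfCardEq hw.2
    refine mem_image.2 ⟨(fun i => (e.symm i : Fin n), fun x => e ⟨w x, mem_stateSet w x⟩),
      mem_univ _, ?_⟩
    ext x
    simp
  refine (card_le_card h).trans (card_image_le.trans (le_of_eq ?_))
  simp

/-- Among all maps `w : X → Fin n`, the total of `n ^ -(#states + 1)` is `O(1 / n)`. -/
theorem sum_inv_pow_card_stateSet_succ_le (X : Type*) [Fintype X] [DecidableEq X] {n : ℕ} (hn : 0 < n) :
    ∑ w : X → Fin n, ((n : ℝ) ^ (#(stateSet w) + 1))⁻¹ ≤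
      ((Fintype.card X + 1) * (Fintype.card X : ℝ) ^ Fintype.card X) / n := by
  set c := Fintype.card X with hc
  have hmaps : ∀ w ∈ (univ : Finset (X → Fin n)), #(stateSet w) ∈ range (c + 1) := fun w _ => by
    rw [mem_range, Nat.lt_succ_iff]
    exact card_image_le
  have hn' : (0 : ℝ) < n := by exact_mod_cast hn
  rw [← sum_fiberwise_of_maps_to hmaps]
  have hterm : ∀ s ∈ range (c + 1), ∑ w : X → Fin n with #(stateSet w) = s,
      ((n : ℝ) ^ (#(stateSet w) + 1))⁻¹ ≤ (c : ℝ) ^ c / n := by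
    intro s hs
    have h1 : ∑ w : X → Fin n with #(stateSet w) = s, ((n : ℝ) ^ (#(stateSet w) + 1))⁻¹ =
        #{w : X → Fin n | #(stateSet w) = s} * ((n : ℝ) ^ (s + 1))⁻¹ := by
      rw [← nsmul_eq_mul, ← sum_const]
      exact sum_congr rfl fun w hw => by rw [(mem_filter.1 hw).2]
    have h2 : (#{w : X → Fin n | #(stateSet w) = s} : ℝ) ≤ (n : ℝ) ^ s * (c : ℝ) ^ c := by
      have h3 : n ^ s * s ^ c ≤ n ^ s * c ^ c :=
        Nat.mul_le_mul_left _ (Nat.pow_le_pow_left (Nat.lt_succ_iff.1 (mem_range.1 hs)) _)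
      exact_mod_cast (card_filter_card_stateSet_eq_le X n s).trans h3
    rw [h1]
    calc _ ≤ ((n : ℝ) ^ s * (c : ℝ) ^ c) * ((n : ℝ) ^ (s + 1))⁻¹ := by gcongr
      _ = (c : ℝ) ^ c / n := by
        rw [pow_succ]
        field_simp
  refine (sum_le_sum hterm).trans (le_of_eq ?_)
  rw [sum_const, card_range, nsmul_eq_mul]
  push_cast
  ring

end Footprint

/-! ### Patterns on a discrete torus -/

section Torus

open Finset

/-- The discrete torus of space-time points; the first coordinate is space. -/
abbrev Torus (M : ℕ) : Type := ZMod M × ZMod M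

/-- The left neighbour of a point of the torus. -/
def leftShift (M : ℕ) (u : Torus M) : Torus M := u - (1, 0)

/-- The successor in time of a point of the torus. -/
def timeShift (M : ℕ) (u : Torus M) : Torus M := u + (0, 1)

variable {M n : ℕ} [NeZero M]

/-- A pattern is regular if the state at a point determines the states at all translates. -/
def IsRegularPattern (w : Torus M → Fin n) : Prop :=
  ∀ u v z, w u = w v → w (u + z) = w (v + z)

/-- Left and time shifts generate the torus as a monoid, since it is finite. Two patterns are
allowed so that the lemma serves both regularity (`w = w'`) and the comparison of distinct patterns.
-/
theorem eq_add_of_shift_eq {w w' : Torus M → Fin n}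
    (hl : ∀ u v, w u = w' v → w (leftShift M u) = w' (leftShift M v))
    (hd : ∀ u v, w u = w' v → w (timeShift M u) = w' (timeShift M v))
    {u v : Torus M} (h : w u = w' v) (z : Torus M) : w (u + z) = w' (v + z) := by
  have h1 : ∀ k : ℕ, w (u + (-(k : ZMod M), 0)) = w' (v + (-(k : ZMod M), 0)) := by
    intro k
    induction k with
    | zero => simpa [Prod.mk_zero_zero] using h
    | succ k ih =>
      convert hl _ _ ih using 2 <;> ext <;> simp [leftShift] <;> ring
  have h2 : ∀ k m : ℕ, w (u + (-(k : ZMod M), (m : ZMod M))) =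
      w' (v + (-(k : ZMod M), (m : ZMod M))) := by
    intro k m
    induction m with
    | zero => simpa using h1 k
    | succ m ih =>
      convert hd _ _ ih using 2 <;> ext <;> simp [timeShift] <;> ring
  have := h2 (-z.1).val z.2.val
  simpa using this

theorem isRegularPattern_of_generates {f : Rule n} {w : Torus M → Fin n}
    (hf : Generates (leftShift M) (timeShift M) f w)
    (hw : #(footprint (leftShift M) w) ≤ #(stateSet w)) : IsRegularPattern w := fun u v z h => by
  have hl : ∀ u v, w u = w v → w (leftShift M u) = w (leftShift M v) :=
    fun u v h => left_eq_of_card_footprint_le hw h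
  exact eq_add_of_shift_eq hl (fun u v h => by rw [hf u, hf v, h, hl u v h]) h z

theorem IsRegularPattern.card_footprint {w : Torus M → Fin n} (hw : IsRegularPattern w) :
    #(footprint (leftShift M) w) = #(stateSet w) :=
  card_footprint_eq_of_left_eq fun x y h => by
    simpa [leftShift, sub_eq_add_neg] using hw x y (-(1, 0)) h

theorem IsRegularPattern.exists_generates {w : Torus M → Fin n} (hw : IsRegularPattern w) :
    ∃ g : Rule n, Generates (leftShift M) (timeShift M) g w := by
  classical
  -- The output depends on the right state alone, through any point carrying it; `a.1` is a dummy
  -- value for unused states.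
  refine ⟨fun a => if h : ∃ u, w u = a.2 then w (timeShift M h.choose) else a.1, fun u => ?_⟩
  have h : ∃ v, w v = w u := ⟨u, rfl⟩
  simp only [h, dif_pos]
  exact hw _ _ _ h.choose_spec.symm

theorem IsRegularPattern.weightOf_generates {w : Torus M → Fin n} (hw : IsRegularPattern w) :
    weightOf (uniformWeight (Rule n)) (fun f => Generates (leftShift M) (timeShift M) f w) =
      ((n : ℝ) ^ #(stateSet w))⁻¹ := by
  obtain ⟨g, hg⟩ := hw.exists_generates
  rw [_root_.weightOf_generates hg, hw.card_footprint]

theorem generates_sumElim_iff {X Y : Type*} {l d : X → X} {l' d' : Y → Y} {f : Rule n}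
    {w : X → Fin n} {w' : Y → Fin n} :
    Generates (Sum.map l l') (Sum.map d d') f (Sum.elim w w') ↔
      Generates l d f w ∧ Generates l' d' f w' := by
  simp [Generates]

theorem stateSet_sumElim {X Y : Type*} [Fintype X] [Fintype Y] (w : X → Fin n) (w' : Y → Fin n) :
    stateSet (Sum.elim w w') = stateSet w ∪ stateSet w' := by
  ext a
  simp [stateSet]

theorem exists_eq_of_not_disjoint_footprint {w w' : Torus M → Fin n}
    (h : ¬ Disjoint (footprint (leftShift M) w) (footprint (leftShift M) w')) :
    ∃ u v, w u = w' v := by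
  rw [not_disjoint_iff] at h
  obtain ⟨a, ha, hb⟩ := h
  simp only [footprint, mem_image, mem_univ, true_and] at ha hb
  obtain ⟨u, rfl⟩ := ha
  obtain ⟨v, hv⟩ := hb
  exact ⟨u, v, (congrArg Prod.snd hv).symm⟩

/-- Distinct regular patterns that share a state, are generated by the same rule and take their
least value at the origin jointly use more pairs than states. -/
theorem card_stateSet_sumElim_lt {f : Rule n} {w w' : Torus M → Fin n}
    (hmin : ∀ u, w 0 ≤ w u) (hmin' : ∀ u, w' 0 ≤ w' u)
    (hf : Generates (leftShift M) (timeShift M) f w)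
    (hf' : Generates (leftShift M) (timeShift M) f w') (hne : w ≠ w') {u v : Torus M}
    (huv : w u = w' v) :
    #(stateSet (Sum.elim w w')) <
      #(footprint (Sum.map (leftShift M) (leftShift M)) (Sum.elim w w')) := by
  by_contra hcon
  rw [not_lt] at hcon
  have hl : ∀ u v, w u = w' v → w (leftShift M u) = w' (leftShift M v) := fun u v h =>
    left_eq_of_card_footprint_le hcon (x := Sum.inl u) (y := Sum.inr v) h
  have key : ∀ u v, w u = w' v → ∀ z, w (u + z) = w' (v + z) := fun u v h z =>
    eq_add_of_shift_eq hl (fun u v h => by rw [hf u, hf' v, h, hl u v h]) h z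
  -- The patterns are translates of each other, so their minima agree; both are attained at the
  -- origin, which forces `w = w'`.
  have h1 : w (u - v) = w' 0 := by simpa [sub_eq_add_neg] using key u v huv (-v)
  have h2 : w 0 = w' (v - u) := by simpa [sub_eq_add_neg] using key u v huv (-u)
  have h0 : w 0 = w' 0 := le_antisymm (h1 ▸ hmin _) (h2 ▸ hmin' _)
  exact hne (funext fun z => by simpa using key 0 0 h0 z)

/-- A pair of patterns is one map on the disjoint union, so pair sums reduce to the single-pattern
estimate `sum_inv_pow_card_stateSet_succ_le`. -/
theorem sum_sum_sumElim_le {X Y β : Type*} [Fintype X] [Fintype Y] [DecidableEq X]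
    [DecidableEq Y] [Fintype β] (I : Finset (X → β)) (J : Finset (Y → β))
    (r : (X → β) → (Y → β) → Prop) {_ : ∀ w w', Decidable (r w w')}
    {a : (X → β) → (Y → β) → ℝ} {F : (X ⊕ Y → β) → ℝ} (hF : ∀ W, 0 ≤ F W)
    (h : ∀ w ∈ I, ∀ w' ∈ J, r w w' → a w w' ≤ F (Sum.elim w w')) :
    ∑ w ∈ I, ∑ w' ∈ J with r w w', a w w' ≤ ∑ W, F W := by
  calc ∑ w ∈ I, ∑ w' ∈ J with r w w', a w w'
      ≤ ∑ w ∈ I, ∑ w' ∈ J with r w w', F (Sum.elim w w') :=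
        sum_le_sum fun w hw => sum_le_sum fun w' hw' =>
          h w hw w' (mem_filter.1 hw').1 (mem_filter.1 hw').2
    _ ≤ ∑ w ∈ I, ∑ w', F (Sum.elim w w') := sum_le_sum fun w _ =>
        sum_le_sum_of_subset_of_nonneg (subset_univ _) fun _ _ _ => hF _
    _ ≤ ∑ w, ∑ w', F (Sum.elim w w') :=
        sum_le_sum_of_subset_of_nonneg (subset_univ _) fun _ _ _ => sum_nonneg fun _ _ => hF _
    _ = ∑ W, F W := by
        rw [← (Equiv.sumArrowEquivProdArrow X Y β).symm.sum_comp, Fintype.sum_prod_type]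
        rfl

/-- Poisson approximation for the number of regular patterns generated by a random rule. -/
theorem abs_weightOf_not_generates_sub_exp_le (hn : 0 < n) (I : Finset (Torus M → Fin n))
    (hreg : ∀ w ∈ I, IsRegularPattern w) (hmin : ∀ w ∈ I, ∀ u, w 0 ≤ w u) :
    |weightOf (uniformWeight (Rule n))
        (fun f => ∀ w ∈ I, ¬ Generates (leftShift M) (timeShift M) f w) -
      Real.exp (-∑ w ∈ I, ((n : ℝ) ^ #(stateSet w))⁻¹)| ≤
      2 * (((Fintype.card (Torus M ⊕ Torus M) + 1) *
        (Fintype.card (Torus M ⊕ Torus M) : ℝ) ^ Fintype.card (Torus M ⊕ Torus M)) / n) := by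
  classical
  have : Nonempty (Rule n) := ⟨fun a => a.1⟩
  have hn1 : (1 : ℝ) ≤ n := by exact_mod_cast hn
  have hn0 : (0 : ℝ) < n := by linarith
  have hmain := abs_weightOf_forall_not_sub_exp_le (uniformWeight (Rule n))
    (uniformWeight_nonneg _) (sum_uniformWeight _) I
    (fun w f => Generates (leftShift M) (timeShift M) f w)
    (fun w w' => ¬ Disjoint (footprint (leftShift M) w) (footprint (leftShift M) w'))
    (fun w _ h => by
      have := mem_footprint (leftShift M) w 0
      rw [disjoint_self_iff_empty] at h
      simp [h] at this)
    (fun w hw s => by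
      obtain ⟨g, hg⟩ := (hreg w hw).exists_generates
      rw [weightOf_generates hg]
      rw [← sum_agree_mul_of_forall_notMem (footprint (leftShift M) w) g]
      · refine sum_congr rfl fun f _ => ?_
        congr 2
        exact if_congr (generates_iff_agree hg f) rfl rfl
      -- The count involves only patterns whose footprint avoids that of `w`, so changing the rule
      -- on the latter does not affect it.
      · intro f f' hff
        congr 2
        ext w'
        simp only [mem_filter, not_not]
        refine and_congr_right fun _ => and_congr_right fun hdisj => ?_
        refine forall_congr' fun u => ?_
        rw [hff _ (disjoint_right.1 hdisj (mem_footprint _ _ _))])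
  rw [sum_congr rfl fun w hw => (hreg w hw).weightOf_generates] at hmain
  refine hmain.trans ?_
  rw [two_mul]
  have hC := sum_inv_pow_card_stateSet_succ_le (Torus M ⊕ Torus M) hn
  refine add_le_add (le_trans ?_ hC) (le_trans ?_ hC)
  · refine sum_sum_sumElim_le I I _ (fun W => by positivity) fun w hw w' hw' h => ?_
    rw [(hreg w hw).weightOf_generates, (hreg w' hw').weightOf_generates, ← mul_inv, ← pow_add]
    -- Meeting footprints share a state, which is counted twice on the right.
    have hcard : #(stateSet (Sum.elim w w')) + 1 ≤ #(stateSet w) + #(stateSet w') := by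
      obtain ⟨u, v, huv⟩ := exists_eq_of_not_disjoint_footprint h
      rw [stateSet_sumElim, ← card_union_add_card_inter (stateSet w)]
      have : 0 < #(stateSet w ∩ stateSet w') := card_pos.2
        ⟨w u, mem_inter.2 ⟨mem_stateSet w u, huv ▸ mem_stateSet w' v⟩⟩
      omega
    gcongr
  · refine sum_sum_sumElim_le I I _ (fun W => by positivity) fun w hw w' hw' h => ?_
    by_cases hg : ∃ f, Generates (leftShift M) (timeShift M) f w ∧
        Generates (leftShift M) (timeShift M) f w'
    · obtain ⟨f, hf, hf'⟩ := hg
      obtain ⟨u, v, huv⟩ := exists_eq_of_not_disjoint_footprint h.1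
      have hlt := card_stateSet_sumElim_lt (hmin w hw) (hmin w' hw') hf hf'
        (Ne.symm h.2) huv
      simp only [← generates_sumElim_iff]
      exact weightOf_generates_le_of_lt _ hlt
    · push Not at hg
      have : ∀ f, ¬ (Generates (leftShift M) (timeShift M) f w ∧
        Generates (leftShift M) (timeShift M) f w') := fun f hf => hg f hf.1 hf.2
      simp only [weightOf, this, if_false, mul_zero, sum_const_zero]
      positivity

/-- A random rule generates a pattern that is not regular with probability `O(1 / n)`. -/
theorem weightOf_exists_not_isRegularPattern_le (M : ℕ) [NeZero M] {n : ℕ} (hn : 0 < n) :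
    weightOf (uniformWeight (Rule n)) (fun f => ∃ w : Torus M → Fin n,
        ¬ IsRegularPattern w ∧ Generates (leftShift M) (timeShift M) f w) ≤
      ((Fintype.card (Torus M) + 1) * (Fintype.card (Torus M) : ℝ) ^ Fintype.card (Torus M)) /
        n := by
  classical
  refine le_trans ?_ (sum_inv_pow_card_stateSet_succ_le (Torus M) hn)
  calc _ ≤ ∑ w : Torus M → Fin n, weightOf (uniformWeight (Rule n))
        (fun f => ¬ IsRegularPattern w ∧ Generates (leftShift M) (timeShift M) f w) :=
        weightOf_exists_le (uniformWeight_nonneg _) _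
    _ ≤ _ := sum_le_sum fun w _ => by
        by_cases h : #(stateSet w) < #(footprint (leftShift M) w)
        · exact (weightOf_mono (uniformWeight_nonneg _) fun f hf => hf.2).trans
            (weightOf_generates_le_of_lt _ h)
        · have : ∀ f, ¬ (¬ IsRegularPattern w ∧ Generates (leftShift M) (timeShift M) f w) :=
            fun f hf => hf.1 (isRegularPattern_of_generates hf.2 (not_lt.1 h))
          simp only [weightOf, this, if_false, mul_zero, sum_const_zero]
          positivity

end Torus

/-! ### Counting rooted regular patterns by period subgroup -/

section Counting

open Finset

/-- Every embedding is a translate, by a unique element of `Q`, of one with its minimum at zero. -/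
theorem card_embedding_min_zero_mul (Q : Type*) [AddCommGroup Q] [Finite Q] (n : ℕ) :
    Nat.card {e : Q ↪ Fin n // ∀ q, e 0 ≤ e q} * Nat.card Q = n.descFactorial (Nat.card Q) := by
  classical
  have := Fintype.ofFinite Q
  let F : {e : Q ↪ Fin n // ∀ q, e 0 ≤ e q} × Q → (Q ↪ Fin n) :=
    fun p => (Equiv.addRight p.2).toEmbedding.trans p.1.1
  have hF : ∀ p x, F p x = p.1.1 (x + p.2) := fun p x => rfl
  have hbij : Function.Bijective F := by
    constructor
    · rintro ⟨⟨e, he⟩, q⟩ ⟨⟨e', he'⟩, q'⟩ h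
      have hx : ∀ x, e (x + q) = e' (x + q') := fun x => by
        simpa only [hF] using congrArg (fun j : Q ↪ Fin n => j x) h
      have h1 : e 0 = e' (-q + q') := by simpa using hx (-q)
      have h2 : e (-q' + q) = e' 0 := by simpa using hx (-q')
      have h3 : e' (-q + q') = e' 0 := le_antisymm (by rw [← h1, ← h2]; exact he _) (he' _)
      have hq : q = q' := by
        have := e'.injective h3
        rwa [neg_add_eq_zero] at this
      subst hq
      have : e = e' := by
        ext x
        have := hx (x - q)
        rw [sub_add_cancel] at this
        rw [this]
      subst this
      rfl
    · intro j
      obtain ⟨m, hm⟩ := Finite.exists_min j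
      refine ⟨⟨⟨(Equiv.addRight m).toEmbedding.trans j, fun q => ?_⟩, -m⟩, ?_⟩
      · simpa using hm (q + m)
      · ext x
        simp [hF]
  rw [← Nat.card_prod, Nat.card_congr (Equiv.ofBijective F hbij), Nat.card_eq_fintype_card,
    Nat.card_eq_fintype_card, Fintype.card_embedding_eq, Fintype.card_fin]

variable {M n : ℕ}

/-- The translations that leave a pattern invariant. -/
def periodGroup (w : Torus M → Fin n) : AddSubgroup (Torus M) where
  carrier := {v | ∀ u, w (u + v) = w u}
  zero_mem' := fun u => by rw [add_zero]
  add_mem' := fun {a b} ha hb u => by rw [← add_assoc, hb, ha]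
  neg_mem' := fun {a} ha u => by rw [← ha (u + -a), neg_add_cancel_right]

theorem mem_periodGroup {w : Torus M → Fin n} {v : Torus M} :
    v ∈ periodGroup w ↔ ∀ u, w (u + v) = w u := Iff.rfl

theorem IsRegularPattern.eq_iff {w : Torus M → Fin n} (hw : IsRegularPattern w) {u v : Torus M} :
    w u = w v ↔ -u + v ∈ periodGroup w := by
  rw [mem_periodGroup]
  constructor
  · intro h z
    have := hw v u (z - u) h.symm
    convert this using 2 <;> abel
  · intro h
    have := h u
    rw [add_neg_cancel_left] at this
    exact this.symm

/-- A regular pattern as an embedding of the quotient by its group of periods. -/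
noncomputable def regularPatternEquiv (L : AddSubgroup (Torus M)) (n : ℕ) :
    {w : Torus M → Fin n // IsRegularPattern w ∧ periodGroup w = L} ≃ ((Torus M ⧸ L) ↪ Fin n) where
  toFun w := ⟨Quotient.lift w.1 (fun u v h => by
      have h' := QuotientAddGroup.leftRel_apply.1 h
      rwa [w.2.1.eq_iff, w.2.2]), by
    rintro ⟨u⟩ ⟨v⟩ h
    refine QuotientAddGroup.eq.2 ?_
    rw [← w.2.2, ← w.2.1.eq_iff]
    exact h⟩
  invFun e := ⟨fun u => e (u : Torus M ⧸ L), fun u v z h => by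
      have := e.injective h
      simp only [QuotientAddGroup.mk_add, this], by
      ext v
      simp only [mem_periodGroup, e.apply_eq_iff_eq, QuotientAddGroup.mk_add, add_eq_left,
        QuotientAddGroup.eq_zero_iff, forall_const]⟩
  left_inv w := by
    ext
    rfl
  right_inv e := by
    ext ⟨u⟩
    rfl

variable [NeZero M]

theorem card_stateSet_eq_index {w : Torus M → Fin n} (hw : IsRegularPattern w) :
    #(stateSet w) = (periodGroup w).index := by
  classical
  have := Fintype.ofFinite (Torus M ⧸ periodGroup w)
  let e := regularPatternEquiv (periodGroup w) n ⟨w, hw, rfl⟩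
  have he : stateSet w = univ.map e := by
    ext a
    simp only [stateSet, mem_image, Finset.mem_map, mem_univ, true_and]
    constructor
    · rintro ⟨u, rfl⟩
      exact ⟨(u : Torus M ⧸ periodGroup w), rfl⟩
    · rintro ⟨⟨u⟩, rfl⟩
      exact ⟨u, rfl⟩
  rw [he, card_map, card_univ, AddSubgroup.index, Nat.card_eq_fintype_card]

open scoped Classical in
/-- The regular patterns with a group of periods in `K` and least value at the origin. -/
noncomputable def rootedPatterns (K : Finset (AddSubgroup (Torus M))) (n : ℕ) :
    Finset (Torus M → Fin n) :=
  {w | IsRegularPattern w ∧ (∀ u, w 0 ≤ w u) ∧ periodGroup w ∈ K}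

theorem card_rooted_mul_index (L : AddSubgroup (Torus M)) (n : ℕ) :
    #(rootedPatterns {L} n) * L.index = n.descFactorial L.index := by
  classical
  rw [AddSubgroup.index, ← card_embedding_min_zero_mul]
  congr 1
  let e : {w // w ∈ rootedPatterns {L} n} ≃ {e : (Torus M ⧸ L) ↪ Fin n // ∀ q, e 0 ≤ e q} :=
    ((Equiv.subtypeEquivRight (q := fun w : Torus M → Fin n =>
        (IsRegularPattern w ∧ periodGroup w = L) ∧ ∀ u, w 0 ≤ w u) (fun w => by
        simp only [rootedPatterns, mem_filter, mem_univ, true_and, mem_singleton]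
        tauto)).trans (Equiv.subtypeSubtypeEquivSubtypeInter _ _).symm).trans
      ((regularPatternEquiv L n).subtypeEquiv (p := fun w => ∀ u : Torus M, w.1 0 ≤ w.1 u) (q := fun e => ∀ q, e 0 ≤ e q) fun w =>
        ⟨by rintro h ⟨u⟩; exact h u, fun h u => h (u : Torus M ⧸ L)⟩)
  rw [← Nat.card_congr e, Nat.card_eq_fintype_card, Fintype.card_coe]

theorem tendsto_descFactorial_div_pow (k : ℕ) :
    Tendsto (fun n : ℕ => (n.descFactorial k : ℝ) / (n : ℝ) ^ k) atTop (𝓝 1) := by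
  refine (Asymptotics.isEquivalent_iff_tendsto_one ?_).1 (isEquivalent_descFactorial k)
  filter_upwards [eventually_gt_atTop 0] with n hn
  have : (0 : ℝ) < n := by exact_mod_cast hn
  positivity

theorem tendsto_sum_rootedPatterns (K : Finset (AddSubgroup (Torus M))) :
    Tendsto (fun n : ℕ => ∑ w ∈ rootedPatterns K n, ((n : ℝ) ^ #(stateSet w))⁻¹) atTop
      (𝓝 (∑ L ∈ K, (L.index : ℝ)⁻¹)) := by
  classical
  have hsum : ∀ n : ℕ, ∑ w ∈ rootedPatterns K n, ((n : ℝ) ^ #(stateSet w))⁻¹ =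
      ∑ L ∈ K, (n.descFactorial L.index : ℝ) / (n : ℝ) ^ L.index * (L.index : ℝ)⁻¹ := by
    intro n
    have hmaps : ∀ w ∈ rootedPatterns K n, periodGroup w ∈ K := fun w hw =>
      (mem_filter.1 hw).2.2.2
    rw [← sum_fiberwise_of_maps_to hmaps]
    refine sum_congr rfl fun L hL => ?_
    have hfil : ({w ∈ rootedPatterns K n | periodGroup w = L} : Finset _) =
        rootedPatterns {L} n := by
      ext w
      simp only [rootedPatterns, mem_filter, mem_univ, true_and, mem_singleton]
      constructor
      · rintro ⟨⟨a, b, -⟩, c⟩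
        exact ⟨a, b, c⟩
      · rintro ⟨a, b, c⟩
        exact ⟨⟨a, b, c ▸ hL⟩, c⟩
    rw [hfil]
    have hconst : ∀ w ∈ rootedPatterns {L} n, ((n : ℝ) ^ #(stateSet w))⁻¹ =
        ((n : ℝ) ^ L.index)⁻¹ := fun w hw => by
      obtain ⟨-, h1, -, h2⟩ := mem_filter.1 hw
      rw [card_stateSet_eq_index h1, mem_singleton.1 h2]
    rw [sum_congr rfl hconst, sum_const, nsmul_eq_mul, ← card_rooted_mul_index]
    have : (L.index : ℝ) ≠ 0 := by exact_mod_cast AddSubgroup.index_ne_zero_of_finite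
    push_cast
    field_simp
  simp only [hsum]
  refine tendsto_finsetSum _ fun L _ => ?_
  simpa using (tendsto_descFactorial_div_pow L.index).mul_const (L.index : ℝ)⁻¹

end Counting

/-! ### Subgroups with prescribed axis periods and the rate `λ` -/

section PeriodRate

open Finset

/-- `σ` and `τ` are the least positive spatial and temporal translations contained in `L`. -/
def HasPeriods {M : ℕ} (L : AddSubgroup (Torus M)) (σ τ : ℕ) : Prop :=
  IsLeast {s : ℕ | 0 < s ∧ ((s : ZMod M), (0 : ZMod M)) ∈ L} σ ∧
  IsLeast {t : ℕ | 0 < t ∧ ((0 : ZMod M), (t : ZMod M)) ∈ L} τ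

/-- The subgroup meets both coordinate axes trivially. -/
def AvoidsAxes {A B : Type*} [AddCommGroup A] [AddCommGroup B] (H : AddSubgroup (A × B)) : Prop :=
  (∀ a, (a, (0 : B)) ∈ H → a = 0) ∧ ∀ b, ((0 : A), b) ∈ H → b = 0

theorem AvoidsAxes.addOrderOf_fst {A B : Type*} [AddCommGroup A] [AddCommGroup B]
    {H : AddSubgroup (A × B)} (hH : AvoidsAxes H) {h : A × B} (hh : h ∈ H) :
    addOrderOf h.1 = addOrderOf h := by
  refine Nat.dvd_antisymm (addOrderOf_dvd_iff_nsmul_eq_zero.2 ?_)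
    (addOrderOf_dvd_iff_nsmul_eq_zero.2 ?_)
  · exact congrArg Prod.fst (addOrderOf_nsmul_eq_zero h)
  · have h1 := H.nsmul_mem hh (addOrderOf h.1)
    have h2 : (addOrderOf h.1 • h).1 = 0 := addOrderOf_nsmul_eq_zero h.1
    exact Prod.ext h2 (hH.2 _ (by rw [← h2]; exact h1))

theorem AvoidsAxes.addOrderOf_snd {A B : Type*} [AddCommGroup A] [AddCommGroup B]
    {H : AddSubgroup (A × B)} (hH : AvoidsAxes H) {h : A × B} (hh : h ∈ H) :
    addOrderOf h.2 = addOrderOf h := by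
  refine Nat.dvd_antisymm (addOrderOf_dvd_iff_nsmul_eq_zero.2 ?_)
    (addOrderOf_dvd_iff_nsmul_eq_zero.2 ?_)
  · exact congrArg Prod.snd (addOrderOf_nsmul_eq_zero h)
  · have h1 := H.nsmul_mem hh (addOrderOf h.2)
    have h2 : (addOrderOf h.2 • h).2 = 0 := addOrderOf_nsmul_eq_zero h.2
    exact Prod.ext (hH.1 _ (by rw [← h2]; exact h1)) h2

/-- Reduction of the torus of size `M` to the torus of size `σ × τ`. -/
def torusReduction {M σ τ : ℕ} (hσ : σ ∣ M) (hτ : τ ∣ M) : Torus M →+ ZMod σ × ZMod τ :=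
  AddMonoidHom.prodMap (ZMod.castHom hσ (ZMod σ)).toAddMonoidHom
    (ZMod.castHom hτ (ZMod τ)).toAddMonoidHom

theorem torusReduction_natCast {M σ τ : ℕ} (hσ : σ ∣ M) (hτ : τ ∣ M) (s t : ℕ) :
    torusReduction hσ hτ ((s : ZMod M), (t : ZMod M)) = ((s : ZMod σ), (t : ZMod τ)) := by
  simp [torusReduction]

theorem AddSubgroup.nsmul_mem_iff_dvd_of_isLeast {A : Type*} [AddGroup A] {L : AddSubgroup A}
    {g : A} {σ : ℕ} (h : IsLeast {s : ℕ | 0 < s ∧ s • g ∈ L} σ) (s : ℕ) :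
    s • g ∈ L ↔ σ ∣ s := by
  constructor
  · intro hs
    by_contra hdvd
    have h1 : (s % σ) • g ∈ L := by
      have h2 : (s % σ) • g = s • g - (s / σ) • σ • g := by
        rw [eq_sub_iff_add_eq, ← mul_nsmul', ← add_nsmul, mul_comm, Nat.mod_add_div]
      rw [h2]
      exact sub_mem hs (L.nsmul_mem h.1.2 _)
    have h3 := h.2 ⟨Nat.pos_of_ne_zero fun h0 => hdvd (Nat.dvd_of_mod_eq_zero h0), h1⟩
    exact absurd (Nat.mod_lt s h.1.1) (not_lt.2 h3)
  · rintro ⟨k, rfl⟩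
    rw [mul_comm, mul_nsmul']
    exact L.nsmul_mem h.1.2 _

/-- A point reducing to zero is a sum of two axis points of `L`, so `L` contains the kernel and is
the preimage of its image. That image avoids the axes because `σ` and `τ` generate the axis periods.
-/
theorem HasPeriods.exists_eq_comap {M σ τ : ℕ} [NeZero M] (hσ : σ ∣ M) (hτ : τ ∣ M) {L : AddSubgroup (Torus M)}
    (hL : HasPeriods L σ τ) :
    ∃ H : AddSubgroup (ZMod σ × ZMod τ), AvoidsAxes H ∧ H.comap (torusReduction hσ hτ) = L := by
  have h1 : ∀ s : ℕ, ((s : ZMod M), (0 : ZMod M)) ∈ L ↔ σ ∣ s := by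
    have e : ∀ s : ℕ, s • ((1 : ZMod M), (0 : ZMod M)) = ((s : ZMod M), 0) := by simp
    have := AddSubgroup.nsmul_mem_iff_dvd_of_isLeast (L := L) (g := ((1 : ZMod M), (0 : ZMod M)))
      (σ := σ) (by simpa only [e] using hL.1)
    simpa only [e] using this
  have h2 : ∀ s : ℕ, ((0 : ZMod M), (s : ZMod M)) ∈ L ↔ τ ∣ s := by
    have e : ∀ s : ℕ, s • ((0 : ZMod M), (1 : ZMod M)) = (0, (s : ZMod M)) := by simp
    have := AddSubgroup.nsmul_mem_iff_dvd_of_isLeast (L := L) (g := ((0 : ZMod M), (1 : ZMod M)))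
      (σ := τ) (by simpa only [e] using hL.2)
    simpa only [e] using this
  have hred : ∀ x : Torus M,
      torusReduction hσ hτ x = ((x.1.val : ZMod σ), (x.2.val : ZMod τ)) := fun x => by
    rw [← torusReduction_natCast hσ hτ, ZMod.natCast_zmod_val, ZMod.natCast_zmod_val]
  have hfst : ∀ x : Torus M, (x.1, (0 : ZMod M)) ∈ L ↔ (x.1.val : ZMod σ) = 0 := fun x => by
    rw [ZMod.natCast_eq_zero_iff, ← h1, ZMod.natCast_zmod_val]
  have hsnd : ∀ x : Torus M, ((0 : ZMod M), x.2) ∈ L ↔ (x.2.val : ZMod τ) = 0 := fun x => by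
    rw [ZMod.natCast_eq_zero_iff, ← h2, ZMod.natCast_zmod_val]
  have hadd : ∀ x : Torus M, x = (x.1, 0) + (0, x.2) := fun x => by simp
  refine ⟨L.map (torusReduction hσ hτ), ⟨?_, ?_⟩, AddSubgroup.comap_map_eq_self ?_⟩
  · rintro a ⟨x, hx, hxa⟩
    rw [hred, Prod.mk.injEq] at hxa
    rw [← hxa.1, ← hfst]
    rw [SetLike.mem_coe, hadd x] at hx
    exact (L.add_mem_cancel_right ((hsnd x).2 hxa.2)).1 hx
  · rintro a ⟨x, hx, hxa⟩
    rw [hred, Prod.mk.injEq] at hxa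
    rw [← hxa.2, ← hsnd]
    rw [SetLike.mem_coe, hadd x] at hx
    exact (L.add_mem_cancel_left ((hfst x).2 hxa.1)).1 hx
  · intro x hx
    rw [AddMonoidHom.mem_ker, hred, Prod.mk_eq_zero] at hx
    rw [hadd x]
    exact add_mem ((hfst x).2 hx.1) ((hsnd x).2 hx.2)

theorem ZMod.addOrderOf_natCast_div {τ d : ℕ} [NeZero τ] (hd : d ∣ τ) :
    addOrderOf ((τ / d : ℕ) : ZMod τ) = d := by
  rw [ZMod.addOrderOf_coe _ (NeZero.ne τ), Nat.gcd_eq_right (Nat.div_dvd_of_dvd hd),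
    Nat.div_div_self hd (NeZero.ne τ)]

/-- The subgroup of `ZMod σ × ZMod τ` meeting the axes trivially that is attached to `a`. -/
noncomputable def slopeSubgroup (σ τ : ℕ) (a : ZMod σ) : AddSubgroup (ZMod σ × ZMod τ) :=
  AddSubgroup.zmultiples (a, ((τ / addOrderOf a : ℕ) : ZMod τ))

variable {σ τ : ℕ} [NeZero τ]

theorem card_slopeSubgroup {a : ZMod σ} (ha : addOrderOf a ∣ τ) :
    Nat.card (slopeSubgroup σ τ a) = addOrderOf a := by
  rw [slopeSubgroup, Nat.card_zmultiples, Prod.addOrderOf, ZMod.addOrderOf_natCast_div ha,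
    Nat.lcm_self]

theorem avoidsAxes_slopeSubgroup {a : ZMod σ} (ha : addOrderOf a ∣ τ) :
    AvoidsAxes (slopeSubgroup σ τ a) := by
  constructor
  · intro x hx
    obtain ⟨k, hk⟩ := AddSubgroup.mem_zmultiples_iff.1 hx
    have h1 : k • a = x := congrArg Prod.fst hk
    rw [← h1]
    have h2 : k • ((τ / addOrderOf a : ℕ) : ZMod τ) = 0 := congrArg Prod.snd hk
    rw [← addOrderOf_dvd_iff_zsmul_eq_zero, ZMod.addOrderOf_natCast_div ha] at h2
    exact addOrderOf_dvd_iff_zsmul_eq_zero.1 h2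
  · intro x hx
    obtain ⟨k, hk⟩ := AddSubgroup.mem_zmultiples_iff.1 hx
    have h1 : k • ((τ / addOrderOf a : ℕ) : ZMod τ) = x := congrArg Prod.snd hk
    rw [← h1]
    have h2 : k • a = 0 := congrArg Prod.fst hk
    rw [← addOrderOf_dvd_iff_zsmul_eq_zero] at h2
    rwa [← addOrderOf_dvd_iff_zsmul_eq_zero, ZMod.addOrderOf_natCast_div ha]

theorem slopeSubgroup_injOn :
    Set.InjOn (slopeSubgroup σ τ) {a | addOrderOf a ∣ τ} := by
  intro a ha a' ha' h
  have hord : addOrderOf a = addOrderOf a' := by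
    rw [← card_slopeSubgroup ha, ← card_slopeSubgroup ha', h]
  have h1 : (a, ((τ / addOrderOf a : ℕ) : ZMod τ)) ∈ slopeSubgroup σ τ a :=
    AddSubgroup.mem_zmultiples _
  have h2 : (a', ((τ / addOrderOf a : ℕ) : ZMod τ)) ∈ slopeSubgroup σ τ a := by
    rw [h, hord]
    exact AddSubgroup.mem_zmultiples _
  have h3 := sub_mem h1 h2
  rw [Prod.mk_sub_mk, sub_self] at h3
  exact sub_eq_zero.1 ((avoidsAxes_slopeSubgroup ha).1 _ h3)

/-- By Lagrange `|K|` annihilates `K`, so `K` lies in the multiples of `τ / |K|`, of which there are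
`|K|`. -/
theorem ZMod.eq_zmultiples_of_card {K : AddSubgroup (ZMod τ)} :
    K = AddSubgroup.zmultiples ((τ / Nat.card K : ℕ) : ZMod τ) := by
  have hd : Nat.card K ∣ τ := by
    simpa using AddSubgroup.card_addSubgroup_dvd_card K
  refine AddSubgroup.eq_of_le_of_card_ge ?_ ?_
  · intro x hx
    have h1 : Nat.card K • x = 0 := congrArg Subtype.val (card_nsmul_eq_zero' (x := (⟨x, hx⟩ : K)))
    rw [← ZMod.natCast_zmod_val x, nsmul_eq_mul, ← Nat.cast_mul, ZMod.natCast_eq_zero_iff] at h1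
    obtain ⟨k, hk⟩ := (Nat.div_dvd_iff_dvd_mul hd Nat.card_pos).2 h1
    refine AddSubgroup.mem_zmultiples_iff.2 ⟨k, ?_⟩
    rw [natCast_zsmul, nsmul_eq_mul, ← Nat.cast_mul, mul_comm, ← hk, ZMod.natCast_zmod_val]
  · rw [Nat.card_zmultiples, ZMod.addOrderOf_natCast_div hd]

variable [NeZero σ]

/-- The second projection is injective on `H`, with image generated by `τ / |H|`. The point of `H`
above this generator has order `|H|`, hence generates `H`; its first coordinate is the required `a`.
-/
theorem AvoidsAxes.exists_eq_slopeSubgroup {H : AddSubgroup (ZMod σ × ZMod τ)}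
    (hH : AvoidsAxes H) : ∃ a, addOrderOf a ∣ τ ∧ slopeSubgroup σ τ a = H := by
  set K := H.map (AddMonoidHom.snd (ZMod σ) (ZMod τ)) with hK
  have hcard : Nat.card K = Nat.card H := by
    refine Nat.card_image_of_injOn (s := (H : Set (ZMod σ × ZMod τ))) fun x hx y hy hxy => ?_
    have h1 : x.2 = y.2 := hxy
    have h2 : (x.1 - y.1, (0 : ZMod τ)) ∈ H := by
      have := sub_mem hx hy
      rwa [show x - y = (x.1 - y.1, 0) from Prod.ext rfl (sub_eq_zero.2 h1)] at this
    exact Prod.ext (sub_eq_zero.1 (hH.1 _ h2)) h1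
  have hmem : ((τ / Nat.card K : ℕ) : ZMod τ) ∈ K := by
    have := AddSubgroup.mem_zmultiples ((τ / Nat.card K : ℕ) : ZMod τ)
    rwa [← ZMod.eq_zmultiples_of_card] at this
  have hd : Nat.card K ∣ τ := by
    simpa using AddSubgroup.card_addSubgroup_dvd_card K
  obtain ⟨⟨a, b⟩, hh, hb⟩ := hmem
  change b = _ at hb
  have hordb : addOrderOf b = Nat.card K := by
    rw [hb, ZMod.addOrderOf_natCast_div hd]
  have hord := (hH.addOrderOf_snd hh).symm.trans hordb
  have horda := (hH.addOrderOf_fst hh).trans hord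
  simp only at horda
  refine ⟨a, horda ▸ hd, ?_⟩
  rw [slopeSubgroup, horda, ← hb]
  refine AddSubgroup.eq_of_le_of_card_ge (AddSubgroup.zmultiples_le_of_mem hh) ?_
  rw [Nat.card_zmultiples, hord, hcard]

variable {M : ℕ}

theorem torusReduction_surjective (hσ : σ ∣ M) (hτ : τ ∣ M) :
    Function.Surjective (torusReduction hσ hτ) := fun p => by
  refine ⟨((p.1.val : ZMod M), (p.2.val : ZMod M)), ?_⟩
  rw [torusReduction_natCast, ZMod.natCast_zmod_val, ZMod.natCast_zmod_val]

theorem AvoidsAxes.hasPeriods_comap (hσ : σ ∣ M) (hτ : τ ∣ M)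
    {H : AddSubgroup (ZMod σ × ZMod τ)} (hH : AvoidsAxes H) :
    HasPeriods (H.comap (torusReduction hσ hτ)) σ τ := by
  have h1 : ∀ s : ℕ, ((s : ZMod M), (0 : ZMod M)) ∈ H.comap (torusReduction hσ hτ) ↔ σ ∣ s := by
    intro s
    rw [← ZMod.natCast_eq_zero_iff, AddSubgroup.mem_comap, ← Nat.cast_zero (R := ZMod M),
      torusReduction_natCast, Nat.cast_zero]
    exact ⟨hH.1 _, fun h => by rw [h]; exact H.zero_mem⟩
  have h2 : ∀ s : ℕ, ((0 : ZMod M), (s : ZMod M)) ∈ H.comap (torusReduction hσ hτ) ↔ τ ∣ s := by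
    intro s
    rw [← ZMod.natCast_eq_zero_iff, AddSubgroup.mem_comap, ← Nat.cast_zero (R := ZMod M),
      torusReduction_natCast, Nat.cast_zero]
    exact ⟨hH.2 _, fun h => by rw [h]; exact H.zero_mem⟩
  simp only [HasPeriods, h1, h2]
  exact ⟨⟨⟨NeZero.pos σ, dvd_rfl⟩, fun s hs => Nat.le_of_dvd hs.1 hs.2⟩,
    ⟨NeZero.pos τ, dvd_rfl⟩, fun s hs => Nat.le_of_dvd hs.1 hs.2⟩

variable [NeZero M]

open scoped Classical in
theorem sum_addOrderOf_eq_periodRate (σ τ : ℕ) [NeZero σ] [NeZero τ] :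
    ∑ a : ZMod σ with addOrderOf a ∣ τ, (addOrderOf a : ℝ) / (σ * τ) = periodRate τ σ := by
  have hmaps : ∀ a ∈ ({a : ZMod σ | addOrderOf a ∣ τ} : Finset _),
      addOrderOf a ∈ (Nat.gcd τ σ).divisors := fun a ha => by
    rw [Nat.mem_divisors]
    refine ⟨Nat.dvd_gcd (mem_filter.1 ha).2 ?_, (Nat.gcd_pos_of_pos_left _ (NeZero.pos τ)).ne'⟩
    simpa using addOrderOf_dvd_card (x := a)
  rw [← sum_fiberwise_of_maps_to hmaps, periodRate, mul_sum]
  refine sum_congr rfl fun d hd => ?_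
  have hd' := Nat.dvd_of_mem_divisors hd
  have hfil : ({a ∈ ({a : ZMod σ | addOrderOf a ∣ τ} : Finset _) | addOrderOf a = d} : Finset _) =
      ({a : ZMod σ | addOrderOf a = d} : Finset _) := by
    ext a
    simp only [mem_filter, mem_univ, true_and, and_iff_right_iff_imp]
    rintro rfl
    exact hd'.trans (Nat.gcd_dvd_left _ _)
  have hcard : #{a : ZMod σ | addOrderOf a = d} = d.totient := by
    refine IsAddCyclic.card_addOrderOf_eq_totient ?_
    simpa using hd'.trans (Nat.gcd_dvd_right _ _)
  have hconst : ∀ a ∈ ({a : ZMod σ | addOrderOf a = d} : Finset _),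
      (addOrderOf a : ℝ) / (σ * τ) = d / (σ * τ) := fun a ha => by rw [(mem_filter.1 ha).2]
  rw [hfil, sum_congr rfl hconst, sum_const, hcard, nsmul_eq_mul]
  ring

open scoped Classical in
/-- The total of the inverse indices of the subgroups with prescribed periods. -/
theorem sum_inv_index_eq_periodRate (hσ : σ ∣ M) (hτ : τ ∣ M) :
    ∑ L : AddSubgroup (Torus M) with HasPeriods L σ τ, (L.index : ℝ)⁻¹ = periodRate τ σ := by
  rw [← sum_addOrderOf_eq_periodRate]
  symm
  refine sum_nbij (fun a => (slopeSubgroup σ τ a).comap (torusReduction hσ hτ)) ?_ ?_ ?_ ?_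
  · intro a ha
    rw [mem_filter] at ha ⊢
    exact ⟨mem_univ _, (avoidsAxes_slopeSubgroup ha.2).hasPeriods_comap hσ hτ⟩
  · intro a ha a' ha' h
    exact slopeSubgroup_injOn (by simpa using ha) (by simpa using ha')
      (AddSubgroup.comap_injective (torusReduction_surjective hσ hτ) h)
  · intro L hL
    rw [coe_filter] at hL
    obtain ⟨H, hH, rfl⟩ := hL.2.exists_eq_comap hσ hτ
    obtain ⟨a, ha, rfl⟩ := hH.exists_eq_slopeSubgroup
    exact ⟨a, by simpa using ha, rfl⟩
  · intro a ha
    rw [mem_filter] at ha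
    rw [AddSubgroup.index_comap_of_surjective _ (torusReduction_surjective hσ hτ)]
    have h1 := AddSubgroup.card_mul_index (slopeSubgroup σ τ a)
    rw [card_slopeSubgroup ha.2, Nat.card_prod, Nat.card_zmod, Nat.card_zmod] at h1
    have h2 : ((slopeSubgroup σ τ a).index : ℝ) ≠ 0 := by
      exact_mod_cast AddSubgroup.index_ne_zero_of_finite
    have h3 : (addOrderOf a : ℝ) ≠ 0 := by exact_mod_cast (addOrderOf_pos a).ne'
    have h4 : (addOrderOf a : ℝ) * (slopeSubgroup σ τ a).index = σ * τ := by exact_mod_cast h1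
    rw [← h4]
    field_simp

end PeriodRate

/-! ### Periodic solutions as unrolled torus patterns -/

section PeriodicSolutions

open Finset

variable {M n : ℕ}

/-- The space-time configuration on `ℤ × ℕ` obtained by unrolling a pattern on the torus. -/
def unroll (w : Torus M → Fin n) : SpaceTime n := fun x t => w ((x : ZMod M), (t : ZMod M))

theorem isTrajectory_unroll {f : Rule n} {w : Torus M → Fin n}
    (hf : Generates (leftShift M) (timeShift M) f w) : IsTrajectory f (unroll w) := fun x t => by
  simpa [unroll, leftShift, timeShift] using hf ((x : ZMod M), (t : ZMod M))

theorem IsRegularPattern.mem_periodGroup_iff {w : Torus M → Fin n} (hw : IsRegularPattern w)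
    (u v : Torus M) : v ∈ periodGroup w ↔ w (u + v) = w u := by
  rw [eq_comm, hw.eq_iff, neg_add_cancel_left]

/-- By regularity a translation fixing the state at one point fixes the whole pattern, so periods of
the initial row are already elements of the period group. -/
theorem IsRegularPattern.isPeriodicSolution_unroll_iff {f : Rule n} {w : Torus M → Fin n}
    (hw : IsRegularPattern w) (hf : Generates (leftShift M) (timeShift M) f w) {σ τ : ℕ} :
    IsPeriodicSolution f τ σ (unroll w) ↔ HasPeriods (periodGroup w) σ τ := by
  have h1 : ∀ s : ℕ, (∀ x : ℤ, unroll w (x + s) 0 = unroll w x 0) ↔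
      ((s : ZMod M), (0 : ZMod M)) ∈ periodGroup w := by
    intro s
    have h : ∀ x : ℤ, unroll w (x + s) 0 = unroll w x 0 ↔
        ((s : ZMod M), (0 : ZMod M)) ∈ periodGroup w := fun x => by
      rw [hw.mem_periodGroup_iff ((x : ZMod M), (0 : ZMod M))]
      simp [unroll]
    simp only [h, forall_const]
  have h2 : ∀ t : ℕ, (∀ x : ℤ, unroll w x t = unroll w x 0) ↔
      ((0 : ZMod M), (t : ZMod M)) ∈ periodGroup w := by
    intro t
    have h : ∀ x : ℤ, unroll w x t = unroll w x 0 ↔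
        ((0 : ZMod M), (t : ZMod M)) ∈ periodGroup w := fun x => by
      rw [hw.mem_periodGroup_iff ((x : ZMod M), (0 : ZMod M))]
      simp [unroll]
    simp only [h, forall_const]
  simp only [IsPeriodicSolution, HasPeriods, h1, h2, isTrajectory_unroll hf, true_and]

variable [NeZero M]

theorem IsTrajectory.eq_of_row_eq {f : Rule n} {ξ η : SpaceTime n} (hξ : IsTrajectory f ξ)
    (hη : IsTrajectory f η) (h : ∀ x, ξ x 0 = η x 0) (x : ℤ) (t : ℕ) : ξ x t = η x t := by
  induction t generalizing x with
  | zero => exact h x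
  | succ t ih => rw [hξ, hη, ih, ih]

/-- Shifted trajectories are trajectories, and the initial row determines a trajectory; periodicity
of that row thus extends to all of space-time. -/
theorem IsPeriodicSolution.exists_eq_unroll {f : Rule n} {ξ : SpaceTime n} {σ τ : ℕ}
    (h : IsPeriodicSolution f τ σ ξ) (hσ : σ ∣ M) (hτ : τ ∣ M) :
    ∃ w : Torus M → Fin n, Generates (leftShift M) (timeShift M) f w ∧ unroll w = ξ := by
  obtain ⟨htr, hs, ht⟩ := h
  have hspace : ∀ x t, ξ (x + σ) t = ξ x t := fun x t => by
    refine IsTrajectory.eq_of_row_eq (f := f) (ξ := fun x t => ξ (x + σ) t) (fun x t => ?_) htr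
      hs.1.2 x t
    change ξ (x + σ) (t + 1) = f (ξ (x - 1 + σ) t, ξ (x + σ) t)
    rw [htr, sub_add_eq_add_sub]
  have htime : ∀ x t, ξ x (t + τ) = ξ x t := fun x t => by
    refine IsTrajectory.eq_of_row_eq (f := f) (ξ := fun x t => ξ x (t + τ)) (fun x t => ?_) htr
      (fun x => ?_) x t
    · change ξ x (t + 1 + τ) = f (ξ (x - 1) (t + τ), ξ x (t + τ))
      rw [add_right_comm, htr]
    · simpa using ht.1.2 x
  have hspace' : ∀ t, Function.Periodic (fun x => ξ x t) (M : ℤ) := fun t => by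
    obtain ⟨k, hk⟩ := hσ
    have := (show Function.Periodic (fun x => ξ x t) (σ : ℤ) from fun x => hspace x t).nat_mul k
    rw [hk]
    push_cast
    rw [mul_comm]
    exact_mod_cast this
  have htime' : ∀ x, Function.Periodic (fun t => ξ x t) M := fun x => by
    obtain ⟨k, hk⟩ := hτ
    have := (show Function.Periodic (fun t => ξ x t) τ from fun t => htime x t).nat_mul k
    rw [hk, mul_comm]
    exact_mod_cast this
  have hrep : ∀ (x : ℤ) (t : ℕ), ξ ((x : ZMod M).val : ℤ) ((t : ZMod M).val) = ξ x t := by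
    intro x t
    rw [ZMod.val_natCast, ZMod.val_intCast, (htime' _).map_mod_nat t]
    have h := (hspace' t).int_mul (x / M) (x % M)
    simp only [Int.cast_id] at h
    rw [← h, mul_comm, Int.emod_add_mul_ediv]
  let w : Torus M → Fin n := fun u => ξ (u.1.val : ℤ) u.2.val
  have hw : unroll w = ξ := by
    funext x t
    exact hrep x t
  refine ⟨w, fun u => ?_, hw⟩
  -- Any integer representatives will do, so no case split is needed where `x - 1` or `t + 1` leaves
  -- the range of `val`.
  have hu : ∀ v : Torus M, ∀ (x : ℤ) (t : ℕ), (x : ZMod M) = v.1 → (t : ZMod M) = v.2 →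
      w v = ξ x t := fun v x t h1 h2 => by
    rw [← hw]
    simp only [unroll, h1, h2]
  rw [hu u u.1.val u.2.val (by simp) (by simp),
    hu (leftShift M u) (u.1.val - 1) u.2.val (by simp [leftShift]) (by simp [leftShift]),
    hu (timeShift M u) u.1.val (u.2.val + 1) (by simp [timeShift]) (by simp [timeShift]), htr]

/-- Every regular pattern has a translate whose least value is at the origin. -/
theorem IsRegularPattern.exists_mem_rootedPatterns {f : Rule n} {w : Torus M → Fin n}
    (hw : IsRegularPattern w) (hf : Generates (leftShift M) (timeShift M) f w)
    {K : Finset (AddSubgroup (Torus M))} (hK : periodGroup w ∈ K) :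
    ∃ w' ∈ rootedPatterns K n, Generates (leftShift M) (timeShift M) f w' := by
  classical
  obtain ⟨m, hm⟩ := Finite.exists_min w
  refine ⟨fun u => w (u + m), ?_, fun u => ?_⟩
  · rw [rootedPatterns, mem_filter]
    refine ⟨mem_univ _, fun u v z h => ?_, fun u => ?_, ?_⟩
    · have := hw _ _ z h
      rwa [add_right_comm u, add_right_comm v] at this
    · simpa using hm (u + m)
    · suffices periodGroup (fun u => w (u + m)) = periodGroup w by rwa [this]
      ext v
      simp only [mem_periodGroup]
      refine ⟨fun h u => ?_, fun h u => ?_⟩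
      · have := h (u - m)
        rwa [add_right_comm, sub_add_cancel] at this
      · rw [add_right_comm, h]
  · have := hf (u + m)
    simp only [leftShift, timeShift] at this ⊢
    rw [add_right_comm, this, sub_add_eq_add_sub]

open scoped Classical in
/-- The subgroups of the torus whose periods belong to `P`. -/
noncomputable def subgroupsWithPeriods (M : ℕ) [NeZero M] (P : Finset (ℕ × ℕ)) :
    Finset (AddSubgroup (Torus M)) :=
  P.biUnion fun p => {L | HasPeriods L p.2 p.1}

theorem sum_subgroupsWithPeriods {P : Finset (ℕ × ℕ)} (hP : ∀ p ∈ P, p.1 ∣ M ∧ p.2 ∣ M) :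
    ∑ L ∈ subgroupsWithPeriods M P, (L.index : ℝ)⁻¹ = ∑ p ∈ P, periodRate p.1 p.2 := by
  classical
  rw [subgroupsWithPeriods, sum_biUnion]
  · refine sum_congr rfl fun p hp => ?_
    have h1 : NeZero p.1 := ⟨fun h => NeZero.ne M (by simpa [h] using (hP p hp).1)⟩
    have h2 : NeZero p.2 := ⟨fun h => NeZero.ne M (by simpa [h] using (hP p hp).2)⟩
    exact sum_inv_index_eq_periodRate (hP p hp).2 (hP p hp).1
  · intro p _ q _ hpq
    -- A subgroup determines its two least axis periods.
    refine disjoint_left.2 fun L hL hL' => hpq ?_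
    rw [mem_filter] at hL hL'
    exact Prod.ext (hL.2.2.unique hL'.2.2) (hL.2.1.unique hL'.2.1)

theorem periodicSolutionsIn_ne_empty_iff {f : Rule n} {T S : Set ℕ} :
    periodicSolutionsIn f T S ≠ ∅ ↔ ∃ τ ∈ T, ∃ σ ∈ S, ∃ ξ, IsPeriodicSolution f τ σ ξ := by
  rw [← Set.nonempty_iff_ne_empty]
  constructor
  · rintro ⟨_, hA⟩
    simp only [periodicSolutionsIn, Set.mem_iUnion, periodicSolutions] at hA
    obtain ⟨p, hp, ξ, hξ, -⟩ := hA
    exact ⟨p.1, hp.1, p.2, hp.2, ξ, hξ⟩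
  · rintro ⟨τ, hτ, σ, hσ, ξ, hξ⟩
    refine ⟨translates ξ, ?_⟩
    simp only [periodicSolutionsIn, Set.mem_iUnion, periodicSolutions]
    exact ⟨(τ, σ), ⟨hτ, hσ⟩, ξ, hξ, rfl⟩

theorem weightOf_not {Ω : Type*} [Fintype Ω] {μ : Ω → ℝ} (hμ : ∑ ω, μ ω = 1) (P : Ω → Prop) :
    weightOf μ (fun ω => ¬ P ω) = 1 - weightOf μ P := by
  classical
  rw [← hμ]
  unfold weightOf
  rw [← sum_sub_distrib]
  refine sum_congr rfl fun ω _ => ?_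
  by_cases h : P ω <;> simp [h]

theorem weightOf_or_le {Ω : Type*} [Fintype Ω] {μ : Ω → ℝ} (hμ : ∀ ω, 0 ≤ μ ω)
    (P Q : Ω → Prop) : weightOf μ (fun ω => P ω ∨ Q ω) ≤ weightOf μ P + weightOf μ Q := by
  classical
  unfold weightOf
  rw [← sum_add_distrib]
  refine sum_le_sum fun ω _ => ?_
  have := hμ ω
  by_cases h : P ω <;> by_cases h' : Q ω <;> simp [h, h', this]

end PeriodicSolutions

/-! ### The limit theorem -/

theorem theorem2 (T S : Set ℕ) (hT : ∀ τ ∈ T, 1 ≤ τ) (hS : ∀ σ ∈ S, 1 ≤ σ)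
    (hfin : (T ×ˢ S).Finite) :
    Tendsto
      (fun n : ℕ => (uniformRule n).real {f : Rule n | periodicSolutionsIn f T S ≠ ∅})
      atTop
      (𝓝 (1 - Real.exp (-∑ p ∈ hfin.toFinset, periodRate p.1 p.2))) := by
  classical
  set P := hfin.toFinset with hP
  have hPmem : ∀ p, p ∈ P ↔ p.1 ∈ T ∧ p.2 ∈ S := fun p => by rw [hP, Set.Finite.mem_toFinset]; rfl
  -- Any positive common multiple of the periods would do.
  set M : ℕ := ∏ p ∈ P, p.1 * p.2 with hM
  have : NeZero M := ⟨Finset.prod_ne_zero_iff.2 fun p hp => by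
    have h1 := hT _ ((hPmem p).1 hp).1
    have h2 := hS _ ((hPmem p).1 hp).2
    positivity⟩
  have hdvd : ∀ p ∈ P, p.1 ∣ M ∧ p.2 ∣ M := fun p hp => by
    have h := Finset.dvd_prod_of_mem (fun p : ℕ × ℕ => p.1 * p.2) hp
    exact ⟨(dvd_mul_right _ _).trans h, (dvd_mul_left _ _).trans h⟩
  set K := subgroupsWithPeriods M P with hK
  have hKmem : ∀ L, L ∈ K ↔ ∃ p ∈ P, HasPeriods L p.2 p.1 := fun L => by
    simp [hK, subgroupsWithPeriods]
  set lam : ℕ → ℝ := fun n => ∑ w ∈ rootedPatterns K n, ((n : ℝ) ^ (stateSet w).card)⁻¹ with hlam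
  have hlim : Tendsto lam atTop (𝓝 (∑ p ∈ P, periodRate p.1 p.2)) := by
    rw [← sum_subgroupsWithPeriods hdvd]
    exact tendsto_sum_rootedPatterns K
  have hlimexp : Tendsto (fun n => 1 - Real.exp (-lam n)) atTop
      (𝓝 (1 - Real.exp (-∑ p ∈ P, periodRate p.1 p.2))) :=
    tendsto_const_nhds.sub ((Real.continuous_exp.tendsto _).comp hlim.neg)
  obtain ⟨C₁, hC₁⟩ : ∃ C : ℝ, ∀ n : ℕ, 0 < n →
      |weightOf (uniformWeight (Rule n)) (fun f => ∀ w ∈ rootedPatterns K n,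
        ¬ Generates (leftShift M) (timeShift M) f w) - Real.exp (-lam n)| ≤ C / n :=
    ⟨_, fun n hn => (abs_weightOf_not_generates_sub_exp_le hn (rootedPatterns K n)
      (fun w hw => (Finset.mem_filter.1 hw).2.1)
      (fun w hw => (Finset.mem_filter.1 hw).2.2.1)).trans_eq (mul_div_assoc _ _ _).symm⟩
  obtain ⟨C₂, hC₂⟩ : ∃ C : ℝ, ∀ n : ℕ, 0 < n →
      weightOf (uniformWeight (Rule n)) (fun f => ∃ w : Torus M → Fin n,
        ¬ IsRegularPattern w ∧ Generates (leftShift M) (timeShift M) f w) ≤ C / n :=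
    ⟨_, fun n hn => weightOf_exists_not_isRegularPattern_le M hn⟩
  have hbound : ∀ n : ℕ, 0 < n →
      |(uniformRule n).real {f : Rule n | periodicSolutionsIn f T S ≠ ∅} -
        (1 - Real.exp (-lam n))| ≤ (C₁ + C₂) / n := by
    intro n hn
    have : Nonempty (Rule n) := ⟨fun a => a.1⟩
    have hμ := uniformWeight_nonneg (Rule n)
    have e1 := hC₁ n hn
    have e2 := hC₂ n hn
    have e3 := weightOf_not (sum_uniformWeight (Rule n)) (fun f => ∀ w ∈ rootedPatterns K n,
      ¬ Generates (leftShift M) (timeShift M) f w)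
    -- A generated rooted pattern always yields a solution; conversely a solution yields one unless
    -- its torus pattern is irregular, an event of weight at most `C₂ / n`.
    have lower : weightOf (uniformWeight (Rule n)) (fun f => ¬ ∀ w ∈ rootedPatterns K n,
        ¬ Generates (leftShift M) (timeShift M) f w) ≤
        weightOf (uniformWeight (Rule n)) (fun f => periodicSolutionsIn f T S ≠ ∅) := by
      refine weightOf_mono hμ fun f hf => ?_
      push Not at hf
      obtain ⟨w, hw, hf⟩ := hf
      obtain ⟨-, hreg, -, hL⟩ := Finset.mem_filter.1 hw
      obtain ⟨p, hp, hper⟩ := (hKmem _).1 hL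
      rw [periodicSolutionsIn_ne_empty_iff]
      exact ⟨p.1, ((hPmem p).1 hp).1, p.2, ((hPmem p).1 hp).2, unroll w,
        (hreg.isPeriodicSolution_unroll_iff hf).2 hper⟩
    have upper : weightOf (uniformWeight (Rule n)) (fun f => periodicSolutionsIn f T S ≠ ∅) ≤
        weightOf (uniformWeight (Rule n)) (fun f => (¬ ∀ w ∈ rootedPatterns K n,
          ¬ Generates (leftShift M) (timeShift M) f w) ∨ ∃ w : Torus M → Fin n,
          ¬ IsRegularPattern w ∧ Generates (leftShift M) (timeShift M) f w) := by
      refine weightOf_mono hμ fun f hf => ?_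
      obtain ⟨τ, hτ, σ, hσ, ξ, hξ⟩ := periodicSolutionsIn_ne_empty_iff.1 hf
      have hp : (τ, σ) ∈ P := (hPmem _).2 ⟨hτ, hσ⟩
      obtain ⟨w, hw, rfl⟩ := hξ.exists_eq_unroll (hdvd _ hp).2 (hdvd _ hp).1
      by_cases hreg : IsRegularPattern w
      · left
        push Not
        exact hreg.exists_mem_rootedPatterns hw
          ((hKmem _).2 ⟨_, hp, (hreg.isPeriodicSolution_unroll_iff hw).1 hξ⟩)
      · exact Or.inr ⟨w, hreg, hw⟩
    have upper' := upper.trans (weightOf_or_le hμ _ _)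
    have e4 := weightOf_nonneg hμ (fun f => ∃ w : Torus M → Fin n,
        ¬ IsRegularPattern w ∧ Generates (leftShift M) (timeShift M) f w)
    rw [uniformRule_real_eq_weightOf, abs_le]
    rw [abs_le] at e1
    rw [add_div]
    constructor <;> linarith [e1.1, e1.2]
  have hzero : Tendsto (fun n : ℕ => (uniformRule n).real
      {f : Rule n | periodicSolutionsIn f T S ≠ ∅} - (1 - Real.exp (-lam n))) atTop (𝓝 0) := by
    refine squeeze_zero_norm' ?_ (tendsto_const_div_atTop_nhds_zero_nat (C₁ + C₂))
    filter_upwards [eventually_gt_atTop 0] with n hn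
    exact hbound n hn
  simpa using hzero.add hlimexp
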